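/- Let $d\ge 1$ and let $K\subset\mathbb R^d$ be a closed bounded convex set with $0$ in its interior. Let $\gamma_K(x)=\inf\{c>0: x\in cK\}$ be its gauge (a norm if $K=-K$; symmetry is not required). For $\lambda>0$, $K$ is a $\lambda$-gauge set if it is $\frac\lambda2$-strongly convex with respect to $\gamma_K$: for all $x,z\in K$, $\theta\in[0,1]$, every $y$ with $\gamma_K\big(y-(\theta x+(1-\theta)z)\big)\le\theta(1-\theta)\frac\lambda4\gamma_K(x-z)^2$ lies in $K$. Let $L>0$ and let $f:K\to\mathbb R$ be convex, differentiable on $K$, and $L$-smooth with respect to $\gamma_K$: $\|\nabla f(x)-\nabla f(z)\|_*\le L\,\gamma_K(x-z)$ for all $x,z\in K$, where $\|y\|_*=\sup_{\gamma_K(u)\le1}\langle y,u\rangle$. No strong convexity of $f$ is assumed. Gauge Frank-Wolfe with step size $\eta$ and initial point $v_0\in K$ does, for $t=1,\dots,T$ with $\beta_t=\frac2{t+1}$ (so that $w_0$ is irrelevant), $$z_t=(1-\beta_t)w_{t-1}+\beta_tv_{t-1},\quad \zeta_t=\sum_{s=1}^t\eta s\,\nabla f(z_s),\quad z_t^*\in\operatorname*{argmin}_{z\in\partial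 K}\langle\zeta_t,z\rangle,$$ $$\rho_t=\max\{0,\min\{1,-\tfrac12\langle\zeta_t,z_t^*\rangle\}\},\quad v_t=\rho_tz_t^*,\quad w_t=(1-\beta_t)w_{t-1}+\beta_tv_t ,$$ and outputs $w_T$. Each round thus uses one gradient, one linear minimization over the boundary $\partial K$ (by an oracle that maps each $\zeta\in\mathbb R^d$ to a minimizer), and the solution of a one-dimensional quadratic problem. Theorem. Let $K$ be a $\lambda$-gauge set, let $f$ be convex and $L$-smooth as above, and let $\frac1{CL}\le\frac\eta\lambda\le\frac1{4L}$ with $C\ge4$. The linear minimization problems over $\partial K$ are solvable, $\min_Kf$ is attained, and for every such oracle, every $v_0\in K$ and every $T\ge1$: (a) $\rho_t$ minimizes $\langle\zeta_t,z_t^*\rangle\rho+\rho^2$ over $\rho\in[0,1]$. With weights $\alpha_t=t$, $x_0=v_0$, $x_t=v_t$ and $y_t=\nabla f(z_t)$ form a play of the Fenchel game $g(x,y)=\langle x,y\rangle-f^*(y)$, where $f^*(y)=\sup_{x\in K}\langle x,y\rangle-f(x)$. Here the $y$-player uses Optimistic Follow-The-Leader, $y_t\in\operatorname{argmin}_{y\in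 Y}\{-\alpha_tg(x_{t-1},y)-\sum_{s<t}\alpha_sg(x_s,y)\}$, with $Y=\bigcup_{x\in K}\partial f(x)$ ($f=+\infty$ off $K$), and the $x$-player uses Be-The-Regularized-Leader with the squared gauge, $x_t\in\operatorname{argmin}_{x\in K}\{\sum_{s\le t}\alpha_sg(x,y_s)+\frac1\eta\gamma_K(x)^2\}$. Moreover $w_T=\sum_{t=1}^Tt\,v_t\big/\sum_{t=1}^Tt\in K$. (b) If $v_0=0$, the minimizer of the regularizer $\gamma_K^2$, then $$f(w_T)-\min_{w\in K}f(w)\le\frac{2CL}{\lambda T^2}.$$ For an arbitrary $v_0\in K$, $$f(w_T)-\min_{w\in K}f(w)\le\frac{2CL}{\lambda T^2}+\frac{2L\,\gamma_K(v_0)^2}{T^2}.$$ -/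

import Mathlib

open scoped BigOperators

/-- The Euclidean space `ℝ^d`. -/
abbrev Rd (d : ℕ) : Type := EuclideanSpace ℝ (Fin d)

/-! ### Strong convexity of sets, dual norms, smoothness

The "norm" is a function `p`; below it is the gauge of `K`, which is a norm when `K` is centrally
symmetric.  For a `K` that is not symmetric, distances are read as `p (x - z)`, for all ordered
pairs `(x, z)`. -/

/-- `K` is an `a`-strongly convex set with respect to `p`: for `x, z ∈ K` and `θ ∈ [0,1]`, the
`p`-ball with centre `θ x + (1-θ) z` and radius `θ (1-θ) (a/2) p(x-z)²` is contained in `K`. -/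
def IsStronglyConvexSet {d : ℕ} (p : Rd d → ℝ) (a : ℝ) (K : Set (Rd d)) : Prop :=
  Convex ℝ K ∧
    ∀ x ∈ K, ∀ z ∈ K, ∀ θ : ℝ, 0 ≤ θ → θ ≤ 1 →
      {y : Rd d | p (y - (θ • x + (1 - θ) • z)) ≤ θ * (1 - θ) * (a / 2) * p (x - z) ^ 2} ⊆ K

/-- A `lam`-gauge set: a closed bounded set with the origin in its interior which is
`lam/2`-strongly convex with respect to its own gauge.  (Boundedness says that the gauge vanishes
only at the origin, as a norm must.) -/
structure IsGaugeSet {d : ℕ} (lam : ℝ) (K : Set (Rd d)) : Prop where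
  lam_pos : 0 < lam
  isClosed : IsClosed K
  isBounded : Bornology.IsBounded K
  zero_mem_interior : (0 : Rd d) ∈ interior K
  stronglyConvex : IsStronglyConvexSet (gauge K) (lam / 2) K

/-- The dual of `p`: `‖y‖_* = sup {⟨y, x⟩ : p x ≤ 1}`. -/
noncomputable def dualNorm {d : ℕ} (p : Rd d → ℝ) (y : Rd d) : ℝ :=
  sSup ((fun x : Rd d => inner ℝ y x) '' {x | p x ≤ 1})

/-- `f` is differentiable on `K` and its gradient is `L`-Lipschitz there, from `p` to the dual
norm of `p`.  Only the values of `f` on `K` matter: derivatives are taken within `K` (and agree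
with the usual gradient wherever `f` is differentiable, if `K` is convex with nonempty
interior). -/
def IsSmoothOn {d : ℕ} (p : Rd d → ℝ) (L : ℝ) (f : Rd d → ℝ) (K : Set (Rd d)) : Prop :=
  DifferentiableOn ℝ f K ∧
    ∀ x ∈ K, ∀ z ∈ K,
      dualNorm p (gradientWithin f K x - gradientWithin f K z) ≤ L * p (x - z)

/-! ### The algorithm -/

/-- `lmo` is a linear minimization oracle over the boundary of `K`:
`lmo ζ ∈ argmin_{z ∈ bndry K} ⟨ζ, z⟩`. -/
def IsBoundaryLMO {d : ℕ} (K : Set (Rd d)) (lmo : Rd d → Rd d) : Prop :=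
  ∀ ζ : Rd d, lmo ζ ∈ frontier K ∧ IsMinOn (fun z : Rd d => inner ℝ ζ z) (frontier K) (lmo ζ)

/-- The variables of Gauge Frank-Wolfe after round `t`: `ζ_t = ∑_{s ≤ t} γ_s ∇f(z_s)`, the query
point `z_t`, the oracle's answer `zstar_t`, the scaling `ρ_t`, and the points `v_t`, `w_t`. -/
structure GaugeFWState (d : ℕ) where
  ζ : Rd d
  z : Rd d
  zstar : Rd d
  ρ : ℝ
  v : Rd d
  w : Rd d

/-- Round `t` of Gauge Frank-Wolfe, with `β_t = 2/(t+1)` and `γ_t = η t`: one gradient, one call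
of the linear minimization oracle, and the solution `ρ_t` of the quadratic problem
`min_{ρ ∈ [0,1]} ⟨ζ_t, zstar_t⟩ ρ + ρ²` in closed form. -/
noncomputable def gaugeFWStep {d : ℕ} (lmo grad : Rd d → Rd d) (η : ℝ) (t : ℕ)
    (S : GaugeFWState d) : GaugeFWState d :=
  let β : ℝ := 2 / ((t : ℝ) + 1)
  let z : Rd d := (1 - β) • S.w + β • S.v
  let ζ : Rd d := S.ζ + (η * (t : ℝ)) • grad z
  let zstar : Rd d := lmo ζ
  let ρ : ℝ := max 0 (min 1 (-(inner ℝ ζ zstar / 2)))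
  let v : Rd d := ρ • zstar
  { ζ := ζ, z := z, zstar := zstar, ρ := ρ, v := v, w := (1 - β) • S.w + β • v }

/-- Gauge Frank-Wolfe from the initial point `v_0 = x_0`.  (Since `β_1 = 1`, the value of `w_0` is
never used with a nonzero weight; neither are the entries `z`, `zstar`, `ρ` at `t = 0`.) -/
noncomputable def gaugeFW {d : ℕ} (lmo grad : Rd d → Rd d) (η : ℝ) (v₀ : Rd d) :
    ℕ → GaugeFWState d
  | 0 => { ζ := 0, z := v₀, zstar := v₀, ρ := 0, v := v₀, w := v₀ }
  | t + 1 => gaugeFWStep lmo grad η (t + 1) (gaugeFW lmo grad η v₀ t)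

/-! ### The Fenchel game and the two online learning strategies -/

/-- The Fenchel conjugate of `f : K → ℝ`, `f*(y) = sup_{x ∈ K} ⟨x, y⟩ - f x`.  (It is finite when
`K` is compact and `f` is continuous on `K`.) -/
noncomputable def fenchelConj {d : ℕ} (K : Set (Rd d)) (f : Rd d → ℝ) (y : Rd d) : ℝ :=
  sSup ((fun x : Rd d => inner ℝ x y - f x) '' K)

/-- The payoff of the Fenchel game, `g(x, y) = ⟨x, y⟩ - f*(y)`. -/
noncomputable def fenchelPayoff {d : ℕ} (K : Set (Rd d)) (f : Rd d → ℝ) (x y : Rd d) : ℝ :=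
  inner ℝ x y - fenchelConj K f y

/-- The gradient space `⋃_{x ∈ K} ∂f(x)`, the decision set of the `y`-player; `f` is regarded as
`+∞` outside `K`. -/
def gradientSpace {d : ℕ} (K : Set (Rd d)) (f : Rd d → ℝ) : Set (Rd d) :=
  {y | ∃ x ∈ K, ∀ z ∈ K, f x + inner ℝ y (z - x) ≤ f z}

/-- `x_1, …, x_T` are chosen by Be-The-Regularized-Leader with regularizer `R` and parameter `η`:
`x_t ∈ argmin_{x ∈ Z} ∑_{s ≤ t} α_s ℓ_s(x) + R(x)/η`. -/
def IsBTRL {d : ℕ} (Z : Set (Rd d)) (R : Rd d → ℝ) (η : ℝ) (α : ℕ → ℝ) (ℓ : ℕ → Rd d → ℝ)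
    (T : ℕ) (x : ℕ → Rd d) : Prop :=
  ∀ t : ℕ, 1 ≤ t → t ≤ T → x t ∈ Z ∧
    IsMinOn (fun u : Rd d => (∑ s ∈ Finset.Icc 1 t, α s * ℓ s u) + 1 / η * R u) Z (x t)

/-- `y_1, …, y_T` are chosen by Optimistic Follow-The-Leader with guesses `m_t`:
`y_t ∈ argmin_{y ∈ Z} α_t m_t(y) + ∑_{s < t} α_s ℓ_s(y)`. -/
def IsOFTL {d : ℕ} (Z : Set (Rd d)) (α : ℕ → ℝ) (m ℓ : ℕ → Rd d → ℝ)
    (T : ℕ) (y : ℕ → Rd d) : Prop :=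
  ∀ t : ℕ, 1 ≤ t → t ≤ T → y t ∈ Z ∧
    IsMinOn (fun u : Rd d => α t * m t u + (∑ s ∈ Finset.Ico 1 t, α s * ℓ s u)) Z (y t)

/-- The sequences `x_0, x_1, …, x_T` and `y_1, …, y_T` are a play of the Fenchel game of `f` over
`K` with weights `α`, where in every round the `y`-player moves first by OFTL with the guesses
`m_t = ℓ_{t-1}`, on the losses `ℓ_t(y) = -g(x_t, y)`, and then the `x`-player moves by
`BTRL[R, η]` on the losses `h_t(x) = g(x, y_t)`. -/
def IsFenchelGamePlay {d : ℕ} (K : Set (Rd d)) (f : Rd d → ℝ) (R : Rd d → ℝ) (η : ℝ)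
    (α : ℕ → ℝ) (T : ℕ) (x y : ℕ → Rd d) : Prop :=
  IsOFTL (gradientSpace K f) α (fun t u => -fenchelPayoff K f (x (t - 1)) u)
      (fun t u => -fenchelPayoff K f (x t) u) T y ∧
    IsBTRL K R η α (fun t u => fenchelPayoff K f u (y t)) T x

/-! With `A_t = t(t+1)/2`, the proof maintains the estimate-sequence bound `η A_t (f(w_t) - f(x)) +
⟨ζ_t, x⟩ ≤ min_K (⟨ζ_t, ·⟩ + γ_K²) + η L γ_K(v₀)²`, where `v_t` attains the minimum
(`gaugeFW.potential_le`). Testing the minimum at `x` bounds it by `⟨ζ_t, x⟩ + 1`; the linear terms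
cancel and the `1/T²` rate remains (`gaugeFW.rate`).

An accelerated round costs at most `η L N²`, with `N` the smaller of the two ordered gauge distances
between `v_{t-1}` and `v_t` (`IsSmoothOn.accelerated_step`). For `t ≥ 2` this is paid by the growth
`(λ/4) N²` of the previous regularized objective away from its minimizer `v_{t-1}`
(`inner_add_sq_gauge_growth`), since `η L ≤ λ/4`. In polar form `x = p u`, with `u` on the boundary,
the growth comes from `p²` radially and from the curvature of `K` angularly (`inner_growth`).

In the first round `v₀` minimizes nothing in general; there the asymmetry bound
`mul_sq_gauge_neg_le` replaces the growth. -/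

theorem le_of_forall_mul_le_of_lt_one {a b : ℝ} (h : ∀ θ : ℝ, 0 < θ → θ < 1 → θ * a ≤ b) :
    a ≤ b := by
  have ht : Filter.Tendsto (fun θ : ℝ => θ * a) (nhdsWithin 1 (Set.Iio 1)) (nhds a) := by
    have : Filter.Tendsto (fun θ : ℝ => θ * a) (nhds 1) (nhds (1 * a)) :=
      (continuous_id.mul continuous_const).tendsto 1
    rw [one_mul] at this
    exact this.mono_left nhdsWithin_le_nhds
  refine le_of_tendsto ht ?_
  filter_upwards [Ioo_mem_nhdsLT (show (0 : ℝ) < 1 by norm_num)] with θ hθ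
  exact h θ hθ.1 hθ.2

/-! ### Geometry of gauge sets and asymmetry of the gauge. -/

namespace IsGaugeSet

variable {d : ℕ} {lam : ℝ} {K : Set (Rd d)}

theorem convex (hK : IsGaugeSet lam K) : Convex ℝ K := hK.stronglyConvex.1

theorem mem_nhds_zero (hK : IsGaugeSet lam K) : K ∈ nhds (0 : Rd d) :=
  mem_interior_iff_mem_nhds.1 hK.zero_mem_interior

theorem zero_mem (hK : IsGaugeSet lam K) : (0 : Rd d) ∈ K := mem_of_mem_nhds hK.mem_nhds_zero

theorem isCompact (hK : IsGaugeSet lam K) : IsCompact K :=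
  Metric.isCompact_of_isClosed_isBounded hK.isClosed hK.isBounded

theorem gauge_le_one_iff (hK : IsGaugeSet lam K) {x : Rd d} : gauge K x ≤ 1 ↔ x ∈ K := by
  rw [gauge_le_one_iff_mem_closure hK.convex hK.mem_nhds_zero, hK.isClosed.closure_eq]

theorem gauge_eq_one_iff (hK : IsGaugeSet lam K) {x : Rd d} :
    gauge K x = 1 ↔ x ∈ frontier K :=
  gauge_eq_one_iff_mem_frontier hK.convex hK.mem_nhds_zero

theorem gauge_pos_iff (hK : IsGaugeSet lam K) {x : Rd d} : 0 < gauge K x ↔ x ≠ 0 :=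
  gauge_pos (absorbent_nhds_zero hK.mem_nhds_zero)
    ((NormedSpace.isVonNBounded_iff ℝ).2 hK.isBounded)

theorem gauge_add_le (hK : IsGaugeSet lam K) (x y : Rd d) :
    gauge K (x + y) ≤ gauge K x + gauge K y :=
  _root_.gauge_add_le hK.convex (absorbent_nhds_zero hK.mem_nhds_zero) x y

theorem gauge_smul {r : ℝ} (hr : 0 ≤ r) (x : Rd d) : gauge K (r • x) = r * gauge K x := by
  rw [gauge_smul_of_nonneg hr, smul_eq_mul]

theorem frontier_subset (hK : IsGaugeSet lam K) : frontier K ⊆ K :=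
  hK.isClosed.frontier_subset

/-- Every point is its gauge times a boundary point, as soon as the boundary is nonempty. -/
theorem exists_eq_gauge_smul (hK : IsGaugeSet lam K) (hne : (frontier K).Nonempty) (x : Rd d) :
    ∃ u ∈ frontier K, x = gauge K x • u := by
  by_cases hx : x = 0
  · obtain ⟨u, hu⟩ := hne
    exact ⟨u, hu, by simp [hx]⟩
  · have hp := hK.gauge_pos_iff.2 hx
    refine ⟨(gauge K x)⁻¹ • x, hK.gauge_eq_one_iff.1 ?_, ?_⟩
    · rw [gauge_smul (inv_nonneg.2 hp.le), inv_mul_cancel₀ hp.ne']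
    · rw [smul_smul, mul_inv_cancel₀ hp.ne', one_smul]

theorem frontier_nonempty (hK : IsGaugeSet lam K) (hd : 0 < d) : (frontier K).Nonempty := by
  have : Nonempty (Fin d) := ⟨⟨0, hd⟩⟩
  obtain ⟨x, hx⟩ := exists_ne (0 : Rd d)
  have hp := hK.gauge_pos_iff.2 hx
  refine ⟨(gauge K x)⁻¹ • x, hK.gauge_eq_one_iff.1 ?_⟩
  rw [gauge_smul (inv_nonneg.2 hp.le), inv_mul_cancel₀ hp.ne']

theorem exists_boundaryLMO (hK : IsGaugeSet lam K) (hd : 0 < d) :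
    ∃ lmo : Rd d → Rd d, IsBoundaryLMO K lmo := by
  have hc : IsCompact (frontier K) := hK.isCompact.of_isClosed_subset isClosed_frontier
    hK.frontier_subset
  have h : ∀ ζ : Rd d, ∃ z ∈ frontier K, IsMinOn (fun z : Rd d => inner ℝ ζ z) (frontier K) z :=
    fun ζ => hc.exists_isMinOn (hK.frontier_nonempty hd) (by fun_prop)
  choose g hg using h
  exact ⟨g, hg⟩

/-- The ball of strong convexity, tested in a single direction `u`. Beyond convexity, this is all
that is used of the hypothesis. -/
theorem add_smul_mem (hK : IsGaugeSet lam K) {x z u : Rd d} (hx : x ∈ K) (hz : z ∈ K)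
    (hu : u ∈ K) {θ : ℝ} (h0 : 0 ≤ θ) (h1 : θ ≤ 1) :
    θ • x + (1 - θ) • z + (θ * (1 - θ) * (lam / 4) * gauge K (x - z) ^ 2) • u ∈ K := by
  apply hK.stronglyConvex.2 x hx z hz θ h0 h1
  have hlam := hK.lam_pos
  have h1' : 0 ≤ 1 - θ := by linarith
  have hr : 0 ≤ θ * (1 - θ) * (lam / 4) * gauge K (x - z) ^ 2 := by positivity
  rw [Set.mem_ofPred_eq, add_sub_cancel_left, gauge_smul hr]
  calc _ ≤ θ * (1 - θ) * (lam / 4) * gauge K (x - z) ^ 2 * 1 :=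
        mul_le_mul_of_nonneg_left (hK.gauge_le_one_iff.2 hu) hr
    _ = _ := by ring

/-- Strong convexity bounds the asymmetry of the gauge. -/
theorem mul_gauge_neg_le (hK : IsGaugeSet lam K) {x : Rd d} (hx : gauge K x = 1) :
    lam * (gauge K (-x) * (gauge K (-x) + 1)) ≤ 4 := by
  have hx0 : x ≠ 0 := hK.gauge_pos_iff.1 (by rw [hx]; norm_num)
  set m := gauge K (-x) with hm
  have hmp : 0 < m := hK.gauge_pos_iff.2 (neg_ne_zero.2 hx0)
  have hxK : x ∈ K := hK.gauge_le_one_iff.1 hx.le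
  have hzK : m⁻¹ • (-x) ∈ K := by
    apply hK.gauge_le_one_iff.1
    rw [gauge_smul (inv_nonneg.2 hmp.le), ← hm, inv_mul_cancel₀ hmp.ne']
  have hgz : gauge K (m⁻¹ • (-x) - x) = m + 1 := by
    have : m⁻¹ • (-x) - x = (m⁻¹ + 1) • (-x) := by module
    rw [this, gauge_smul (by positivity), ← hm]
    field_simp
    ring
  -- On the chord from the opposite boundary point to `x`, the push is along `x`, so the result is
  -- `c • x` and `c ≤ 1`. A factor `1 - θ` cancels; then `θ → 1`.
  have key : ∀ θ : ℝ, 0 < θ → θ < 1 → θ * (lam / 4 * (m + 1) ^ 2) ≤ m⁻¹ + 1 := by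
    intro θ h0 h1
    have h := hK.add_smul_mem hzK hxK hxK (θ := 1 - θ) (by linarith) (by linarith)
    rw [hgz] at h
    set c := 1 - (1 - θ) * (m⁻¹ + 1) + (1 - θ) * (1 - (1 - θ)) * (lam / 4) * (m + 1) ^ 2 with hc
    have he : (1 - θ) • m⁻¹ • -x + (1 - (1 - θ)) • x
        + ((1 - θ) * (1 - (1 - θ)) * (lam / 4) * (m + 1) ^ 2) • x = c • x := by
      rw [hc]; module
    rw [he] at h
    have hc1 : c ≤ 1 := by
      by_contra hlt
      push Not at hlt
      have := hK.gauge_le_one_iff.2 h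
      rw [gauge_smul (by linarith), hx] at this
      linarith
    have : (1 - θ) * (θ * (lam / 4 * (m + 1) ^ 2)) ≤ (1 - θ) * (m⁻¹ + 1) := by
      rw [hc] at hc1; linarith
    exact le_of_mul_le_mul_left this (by linarith)
  have h := le_of_forall_mul_le_of_lt_one key
  have h2 : m * (lam / 4 * (m + 1) ^ 2) ≤ m + 1 := by
    calc _ ≤ m * (m⁻¹ + 1) := mul_le_mul_of_nonneg_left h hmp.le
      _ = m + 1 := by field_simp; ring
  have h3 : (m + 1) * (lam / 4 * (m * (m + 1))) ≤ (m + 1) * 1 := by linarith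
  have := le_of_mul_le_mul_left h3 (by linarith)
  linarith

/-- Homogeneous form of `mul_gauge_neg_le`, used to control `γ_K(-v₁)` in the first round. -/
theorem mul_sq_gauge_neg_le (hK : IsGaugeSet lam K) (x : Rd d) :
    lam * gauge K (-x) ^ 2 ≤ 4 * gauge K x ^ 2 := by
  by_cases hx : x = 0
  · simp [hx]
  have hp := hK.gauge_pos_iff.2 hx
  have h := hK.mul_gauge_neg_le (x := (gauge K x)⁻¹ • x)
    (by rw [gauge_smul (inv_nonneg.2 hp.le), inv_mul_cancel₀ hp.ne'])
  rw [← smul_neg, gauge_smul (inv_nonneg.2 hp.le)] at h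
  set p := gauge K x
  set q := gauge K (-x)
  have hq : 0 ≤ q := gauge_nonneg _
  have hlam := hK.lam_pos
  have h1 : lam * (p⁻¹ * q) ^ 2 ≤ 4 := by
    have : 0 ≤ lam * (p⁻¹ * q) := by positivity
    nlinarith
  calc lam * q ^ 2 = lam * (p⁻¹ * q) ^ 2 * p ^ 2 := by field_simp
    _ ≤ 4 * p ^ 2 := mul_le_mul_of_nonneg_right h1 (sq_nonneg p)

/-- On every line through 0 one of the two boundary points has reversed gauge at least 1; there
`mul_gauge_neg_le` gives `2 * lam ≤ 4`. -/
theorem lam_le_two (hK : IsGaugeSet lam K) (hd : 0 < d) : lam ≤ 2 := by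
  have aux : ∀ x : Rd d, gauge K x = 1 → 1 ≤ gauge K (-x) → lam ≤ 2 := by
    intro x hx h
    have := hK.mul_gauge_neg_le hx
    have hlam := hK.lam_pos
    nlinarith [mul_nonneg hlam.le (mul_nonneg (sub_nonneg.2 h) (by linarith : 0 ≤ gauge K (-x) + 2))]
  obtain ⟨x, hx⟩ := hK.frontier_nonempty hd
  have hx1 := hK.gauge_eq_one_iff.2 hx
  by_cases h : 1 ≤ gauge K (-x)
  · exact aux x hx1 h
  · push Not at h
    have hx0 : x ≠ 0 := hK.gauge_pos_iff.1 (by rw [hx1]; norm_num)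
    have hp := hK.gauge_pos_iff.2 (neg_ne_zero.2 hx0)
    refine aux ((gauge K (-x))⁻¹ • (-x)) ?_ ?_
    · rw [gauge_smul (inv_nonneg.2 hp.le), inv_mul_cancel₀ hp.ne']
    · rw [← smul_neg, neg_neg, gauge_smul (inv_nonneg.2 hp.le), hx1, mul_one]
      exact (one_le_inv₀ hp).2 h.le

/-! ### Linear minimization over the boundary and quadratic growth. -/

variable {ζ z : Rd d}

/-- The ray through `-z` also meets the boundary, and a positive value at `z` would be negative
there. -/
theorem inner_le_zero_of_isMinOn (hK : IsGaugeSet lam K) (hz : z ∈ frontier K)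
    (hmin : IsMinOn (fun u : Rd d => inner ℝ ζ u) (frontier K) z) : inner ℝ ζ z ≤ 0 := by
  have hz0 : z ≠ 0 := hK.gauge_pos_iff.1 (by rw [hK.gauge_eq_one_iff.2 hz]; norm_num)
  have hp := hK.gauge_pos_iff.2 (neg_ne_zero.2 hz0)
  have hu : (gauge K (-z))⁻¹ • (-z) ∈ frontier K := hK.gauge_eq_one_iff.1
    (by rw [gauge_smul (inv_nonneg.2 hp.le), inv_mul_cancel₀ hp.ne'])
  have h : inner ℝ ζ z ≤ inner ℝ ζ ((gauge K (-z))⁻¹ • (-z)) := hmin hu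
  rw [inner_smul_right, inner_neg_right] at h
  by_contra hlt
  push Not at hlt
  have := mul_pos (inv_pos.2 hp) hlt
  linarith

/-- For `x = p u`, `⟨ζ, x⟩ = p⟨ζ, u⟩ ≥ p⟨ζ, z⟩ ≥ ⟨ζ, z⟩`, because `p ≤ 1` and the minimum is
nonpositive. -/
theorem inner_le_of_isMinOn (hK : IsGaugeSet lam K) (hz : z ∈ frontier K)
    (hmin : IsMinOn (fun u : Rd d => inner ℝ ζ u) (frontier K) z) {x : Rd d} (hx : x ∈ K) :
    inner ℝ ζ z ≤ inner ℝ ζ x := by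
  obtain ⟨u, hu, hxu⟩ := hK.exists_eq_gauge_smul ⟨z, hz⟩ x
  have h : inner ℝ ζ z ≤ inner ℝ ζ u := hmin hu
  have h0 := hK.inner_le_zero_of_isMinOn hz hmin
  have h1 := hK.gauge_le_one_iff.2 hx
  have h2 : (0 : ℝ) ≤ gauge K x := gauge_nonneg x
  rw [hxu, inner_smul_right]
  nlinarith [mul_le_mul_of_nonneg_left h h2]

/-- Points of the segment from `x` to `z` may be pushed further along `z` without leaving `K`.
Minimality of `z` against them, divided by `1 - θ`, gives the bound as `θ → 1`. The endpoints can be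
taken in either order, hence the two choices of `δ`. -/
theorem inner_growth (hK : IsGaugeSet lam K) (hz : z ∈ frontier K)
    (hmin : IsMinOn (fun u : Rd d => inner ℝ ζ u) (frontier K) z) {x : Rd d} (hx : x ∈ K)
    {δ : ℝ} (hδ : δ = gauge K (x - z) ∨ δ = gauge K (z - x)) :
    inner ℝ ζ z - lam / 4 * δ ^ 2 * inner ℝ ζ z ≤ inner ℝ ζ x := by
  have hzK := hK.frontier_subset hz
  have key : ∀ θ : ℝ, 0 < θ → θ < 1 →
      θ * (-(lam / 4 * δ ^ 2 * inner ℝ ζ z)) ≤ inner ℝ ζ x - inner ℝ ζ z := by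
    intro θ h0 h1
    have hmem : (1 - θ) • x + θ • z + ((1 - θ) * θ * (lam / 4) * δ ^ 2) • z ∈ K := by
      rcases hδ with rfl | rfl
      · have := hK.add_smul_mem hx hzK hzK (θ := 1 - θ) (by linarith) (by linarith)
        rwa [sub_sub_cancel] at this
      · have := hK.add_smul_mem hzK hx hzK h0.le h1.le
        rwa [add_comm (θ • z), mul_comm θ (1 - θ)] at this
    have h := hK.inner_le_of_isMinOn hz hmin hmem
    simp only [inner_add_right, inner_smul_right] at h
    have : (1 - θ) * (θ * (-(lam / 4 * δ ^ 2 * inner ℝ ζ z))) ≤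
        (1 - θ) * (inner ℝ ζ x - inner ℝ ζ z) := by linarith
    exact le_of_mul_le_mul_left this (by linarith)
  have := le_of_forall_mul_le_of_lt_one key
  linarith

/-- Quadratic growth of `⟨ζ, x⟩ + γ_K(x)²` over `K` at its minimizer. -/
theorem inner_add_sq_gauge_growth (hK : IsGaugeSet lam K) (hd : 0 < d) (hz : z ∈ frontier K)
    (hmin : IsMinOn (fun u : Rd d => inner ℝ ζ u) (frontier K) z) {ρ : ℝ}
    (hρ : ρ = max 0 (min 1 (-(inner ℝ ζ z / 2)))) {x : Rd d} (hx : x ∈ K) :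
    inner ℝ ζ (ρ • z) + gauge K (ρ • z) ^ 2 +
        lam / 4 * min (gauge K (x - ρ • z)) (gauge K (ρ • z - x)) ^ 2 ≤
      inner ℝ ζ x + gauge K x ^ 2 := by
  obtain ⟨u, hu, hxu⟩ := hK.exists_eq_gauge_smul ⟨z, hz⟩ x
  have hlam := hK.lam_pos
  have hlam2 := hK.lam_le_two hd
  have hz1 := hK.gauge_eq_one_iff.2 hz
  have hu1 := hK.gauge_eq_one_iff.2 hu
  have huK := hK.frontier_subset hu
  have hS := hK.inner_le_zero_of_isMinOn hz hmin
  have hp0 : 0 ≤ gauge K x := gauge_nonneg x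
  have hp1 := hK.gauge_le_one_iff.2 hx
  set p := gauge K x with hp
  set s : ℝ := inner ℝ ζ z with hs
  have hρ0 : 0 ≤ ρ := hρ ▸ le_max_left _ _
  have hρmin : ρ = min 1 (-(s / 2)) := by
    rw [hρ, max_eq_right]
    exact le_min zero_le_one (by linarith)
  have hρs : 2 * ρ ≤ -s := by
    have := min_le_right 1 (-(s / 2)); rw [← hρmin] at this; linarith
  -- First-order optimality of `ρ` for `r s + r²` on `[0,1]`; it yields the radial growth `(p -
  -- ρ)²`.
  have hprod : 0 ≤ (p - ρ) * (2 * ρ + s) := by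
    rcases min_choice 1 (-(s / 2)) with h | h
    · have h1 : ρ = 1 := by rw [hρmin, h]
      exact mul_nonneg_of_nonpos_of_nonpos (by linarith) (by linarith)
    · have h1 : ρ = -(s / 2) := by rw [hρmin, h]
      have : 2 * ρ + s = 0 := by linarith
      rw [this, mul_zero]
  have hgρ : gauge K (ρ • z) = ρ := by rw [gauge_smul hρ0, hz1, mul_one]
  set N := min (gauge K (x - ρ • z)) (gauge K (ρ • z - x)) with hN
  have hN0 : 0 ≤ N := le_min (gauge_nonneg _) (gauge_nonneg _)
  -- `D` is the radial and `m * δ` the angular part of the distance. After `(D + mδ)² ≤ 2D² +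
  -- 2m²δ²`, the radial term is affordable because `lam ≤ 2`, the angular one because `-s ≥ 2ρ` and
  -- `m² ≤ pρ`.
  have main : ∀ δ D m : ℝ, (δ = gauge K (u - z) ∨ δ = gauge K (z - u)) → N ≤ D + m * δ →
      D ^ 2 = (p - ρ) ^ 2 → 0 ≤ m → m ^ 2 ≤ p * ρ →
      inner ℝ ζ (ρ • z) + gauge K (ρ • z) ^ 2 + lam / 4 * N ^ 2 ≤ inner ℝ ζ x + p ^ 2 := by
    intro δ D m hδ hND hD hm hmp
    have h1 := hK.inner_growth hz hmin huK hδ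
    rw [← hs] at h1
    rw [hgρ, hxu, inner_smul_right, inner_smul_right, ← hs]
    have h2 := mul_le_mul_of_nonneg_left h1 hp0
    have h3 : N ^ 2 ≤ 2 * D ^ 2 + 2 * m ^ 2 * δ ^ 2 := by
      calc N ^ 2 ≤ (D + m * δ) ^ 2 := pow_le_pow_left₀ hN0 hND 2
        _ ≤ _ := by nlinarith [sq_nonneg (D - m * δ)]
    have h4 : lam / 4 * N ^ 2 ≤ D ^ 2 + lam / 2 * (p * ρ) * δ ^ 2 := by
      have h5 : lam / 4 * N ^ 2 ≤ lam / 4 * (2 * D ^ 2 + 2 * m ^ 2 * δ ^ 2) :=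
        mul_le_mul_of_nonneg_left h3 (by linarith)
      have h6 : lam / 2 * D ^ 2 ≤ 1 * D ^ 2 :=
        mul_le_mul_of_nonneg_right (by linarith) (sq_nonneg D)
      have h7 : lam / 2 * δ ^ 2 * m ^ 2 ≤ lam / 2 * δ ^ 2 * (p * ρ) :=
        mul_le_mul_of_nonneg_left hmp (by positivity)
      linarith
    have h8 : lam / 4 * δ ^ 2 * p * (2 * ρ) ≤ lam / 4 * δ ^ 2 * p * (-s) :=
      mul_le_mul_of_nonneg_left hρs (by positivity)
    rw [hD] at h4
    linarith
  -- Taking `m = min p ρ` ensures `m² ≤ pρ`. The sign of `p - ρ` decides which ordered distance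
  -- splits this way, hence the minimum in the statement.
  rcases le_total ρ p with h | h
  · refine main _ (p - ρ) ρ (Or.inl rfl) ?_ rfl hρ0 (by nlinarith)
    calc N ≤ gauge K (x - ρ • z) := min_le_left _ _
      _ = gauge K ((p - ρ) • u + ρ • (u - z)) := by
        congr 1
        rw [hxu]; module
      _ ≤ gauge K ((p - ρ) • u) + gauge K (ρ • (u - z)) := hK.gauge_add_le _ _
      _ = _ := by rw [gauge_smul (by linarith), gauge_smul hρ0, hu1, mul_one]
  · refine main _ (ρ - p) p (Or.inr rfl) ?_ (by ring) hp0 (by nlinarith)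
    calc N ≤ gauge K (ρ • z - x) := min_le_right _ _
      _ = gauge K ((ρ - p) • z + p • (z - u)) := by
        congr 1
        rw [hxu]; module
      _ ≤ gauge K ((ρ - p) • z) + gauge K (p • (z - u)) := hK.gauge_add_le _ _
      _ = _ := by rw [gauge_smul (by linarith), gauge_smul hp0, hz1, mul_one]

end IsGaugeSet

/-! ### Dual norm, convexity and descent. -/

theorem IsGaugeSet.inner_le_dualNorm_mul {d : ℕ} {lam : ℝ} {K : Set (Rd d)}
    (hK : IsGaugeSet lam K) (y u : Rd d) :
    inner ℝ y u ≤ dualNorm (gauge K) y * gauge K u := by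
  by_cases hu : u = 0
  · simp [hu]
  have hp := hK.gauge_pos_iff.2 hu
  -- Needed for `sSup` to be a genuine supremum: the unit ball of the gauge is the compact set `K`.
  have hbdd : BddAbove ((fun x : Rd d => inner ℝ y x) '' {x | gauge K x ≤ 1}) := by
    have : {x | gauge K x ≤ 1} = K := Set.ext fun x => hK.gauge_le_one_iff
    rw [this]
    exact hK.isCompact.bddAbove_image (by fun_prop)
  have h : inner ℝ y ((gauge K u)⁻¹ • u) ≤ dualNorm (gauge K) y := by
    refine le_csSup hbdd ⟨_, ?_, rfl⟩
    rw [Set.mem_ofPred_eq, IsGaugeSet.gauge_smul (inv_nonneg.2 hp.le), inv_mul_cancel₀ hp.ne']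
  rw [inner_smul_right, inv_mul_le_iff₀ hp] at h
  linarith

section

variable {d : ℕ} {K : Set (Rd d)} {f : Rd d → ℝ}

theorem hasDerivWithinAt_comp_segment (hc : Convex ℝ K) (hf : DifferentiableOn ℝ f K)
    {x z : Rd d} (hx : x ∈ K) (hz : z ∈ K) {s : ℝ} (hs : s ∈ Set.Icc (0 : ℝ) 1) :
    HasDerivWithinAt (fun r : ℝ => f (x + r • (z - x)))
      (inner ℝ (gradientWithin f K (x + s • (z - x))) (z - x)) (Set.Icc 0 1) s := by
  have hmaps : Set.MapsTo (fun r : ℝ => x + r • (z - x)) (Set.Icc 0 1) K :=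
    fun r hr => hc.add_smul_sub_mem hx hz hr
  have h1 := ((hf _ (hmaps hs)).hasGradientWithinAt).hasFDerivWithinAt
  have h2 : HasDerivWithinAt (fun r : ℝ => x + r • (z - x)) (z - x) (Set.Icc 0 1) s := by
    simpa using (((hasDerivAt_id s).smul_const (z - x)).const_add x).hasDerivWithinAt
  have h3 := h1.comp_hasDerivWithinAt s h2 hmaps
  rwa [InnerProductSpace.toDual_apply_apply] at h3

theorem ConvexOn.add_inner_gradientWithin_le (hconv : ConvexOn ℝ K f)
    (hf : DifferentiableOn ℝ f K) {x z : Rd d} (hx : x ∈ K) (hz : z ∈ K) :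
    f x + inner ℝ (gradientWithin f K x) (z - x) ≤ f z := by
  have hd := hasDerivWithinAt_comp_segment hconv.1 hf hx hz (s := 0) (by simp)
  have hg : ConvexOn ℝ (Set.Icc (0 : ℝ) 1) (fun r : ℝ => f (x + r • (z - x))) := by
    refine ⟨convex_Icc 0 1, fun a ha b hb p q hp hq hpq => ?_⟩
    have h := hconv.2 (hconv.1.add_smul_sub_mem hx hz ha) (hconv.1.add_smul_sub_mem hx hz hb)
      hp hq hpq
    convert h using 2
    have : x = p • x + q • x := by rw [← add_smul, hpq, one_smul]
    calc x + (p • a + q • b) • (z - x) = (p • x + q • x) + (p • a + q • b) • (z - x) := by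
          rw [← this]
      _ = _ := by simp only [smul_eq_mul]; module
  have h := hg.le_slope_of_hasDerivWithinAt (by simp) (by simp) zero_lt_one hd
  rw [slope_def_field] at h
  simp only [zero_smul, add_zero, one_smul, add_sub_cancel, sub_zero, div_one] at h
  linarith

/-- The descent inequality, with the smaller of the two asymmetric distances. -/
theorem IsSmoothOn.descent {lam L : ℝ} (hK : IsGaugeSet lam K)
    (hsm : IsSmoothOn (gauge K) L f K) {x z : Rd d} (hx : x ∈ K) (hz : z ∈ K) :
    f z ≤ f x + inner ℝ (gradientWithin f K x) (z - x) +
      L / 2 * min (gauge K (z - x)) (gauge K (x - z)) ^ 2 := by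
  set N := min (gauge K (z - x)) (gauge K (x - z)) with hN
  set G := gradientWithin f K with hG
  have hlip : ∀ a ∈ K, ∀ b ∈ K,
      inner ℝ (G a - G b) (a - b) ≤ L * gauge K (a - b) ^ 2 := by
    intro a ha b hb
    calc _ ≤ dualNorm (gauge K) (G a - G b) * gauge K (a - b) := hK.inner_le_dualNorm_mul _ _
      _ ≤ L * gauge K (a - b) * gauge K (a - b) :=
        mul_le_mul_of_nonneg_right (hsm.2 a ha b hb) (gauge_nonneg _)
      _ = _ := by ring
  have hslope : ∀ s ∈ Set.Icc (0 : ℝ) 1,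
      inner ℝ (G (x + s • (z - x)) - G x) (z - x) ≤ s * (L * N ^ 2) := by
    intro s hs
    rcases hs.1.eq_or_lt with rfl | hs0
    · simp
    have hy := hK.convex.add_smul_sub_mem hx hz hs
    set y := x + s • (z - x) with hy'
    -- Swapping the two points leaves the inner product unchanged but reverses the gauge distance,
    -- so both distances bound it.
    have h1 := hlip y hy x hx
    have h2 := hlip x hx y hy
    have e1 : y - x = s • (z - x) := by rw [hy']; module
    have e2 : x - y = s • (x - z) := by rw [hy']; module
    rw [e1, inner_smul_right, IsGaugeSet.gauge_smul hs0.le] at h1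
    have e3 : inner ℝ (G x - G y) (x - y) = s * inner ℝ (G y - G x) (z - x) := by
      rw [e2, inner_smul_right, ← neg_sub (G y), ← neg_sub z, inner_neg_neg]
    rw [e3, e2, IsGaugeSet.gauge_smul hs0.le] at h2
    refine le_of_mul_le_mul_left ?_ hs0
    rcases min_choice (gauge K (z - x)) (gauge K (x - z)) with h | h
    · rw [hN, h]; linarith
    · rw [hN, h]; linarith
  have hanti : AntitoneOn
      (fun r : ℝ => f (x + r • (z - x)) - (r * inner ℝ (G x) (z - x) + L * N ^ 2 / 2 * r ^ 2))
      (Set.Icc 0 1) := by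
    have hder : ∀ s ∈ Set.Icc (0 : ℝ) 1, HasDerivWithinAt
        (fun r : ℝ => f (x + r • (z - x)) - (r * inner ℝ (G x) (z - x) + L * N ^ 2 / 2 * r ^ 2))
        (inner ℝ (G (x + s • (z - x))) (z - x) - (inner ℝ (G x) (z - x) + L * N ^ 2 * s))
        (Set.Icc 0 1) s := by
      intro s hs
      refine (hasDerivWithinAt_comp_segment hK.convex hsm.1 hx hz hs).sub
        (HasDerivAt.hasDerivWithinAt ?_)
      have h1 := (hasDerivAt_id s).mul_const (inner ℝ (G x) (z - x))
      have h2 := ((hasDerivAt_id s).pow 2).const_mul (L * N ^ 2 / 2)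
      refine (h1.add h2).congr_deriv ?_
      simp only [id, Nat.cast_ofNat]
      ring
    refine antitoneOn_of_hasDerivWithinAt_nonpos (convex_Icc 0 1)
      (fun s hs => (hder s hs).continuousWithinAt)
      (fun s hs => (hder s (interior_subset hs)).mono interior_subset) fun s hs => ?_
    have := hslope s (interior_subset hs)
    rw [inner_sub_left] at this
    linarith
  have h := hanti (a := 0) (b := 1) (by simp) (by simp) zero_le_one
  simp only [zero_smul, add_zero, one_smul, add_sub_cancel, zero_mul, ne_eq, OfNat.ofNat_ne_zero,
    not_false_eq_true, zero_pow, mul_zero, sub_zero, one_mul, one_pow, mul_one] at h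
  linarith

end

/-! ### Fenchel conjugate and gradient space. -/

section FenchelConj

variable {d : ℕ} {K : Set (Rd d)} {f : Rd d → ℝ}

theorem inner_sub_le_fenchelConj (hK : IsCompact K) (hf : ContinuousOn f K) {x : Rd d}
    (hx : x ∈ K) (y : Rd d) : inner ℝ x y - f x ≤ fenchelConj K f y := by
  refine le_csSup (hK.bddAbove_image ?_) ⟨x, hx, rfl⟩
  exact ContinuousOn.sub (by fun_prop) hf

/-- The nontrivial half of Fenchel–Young equality: the gradient inequality says that `x` attains the
supremum. -/
theorem fenchelConj_gradientWithin_le (hconv : ConvexOn ℝ K f) (hf : DifferentiableOn ℝ f K)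
    {x : Rd d} (hx : x ∈ K) :
    fenchelConj K f (gradientWithin f K x) ≤ inner ℝ x (gradientWithin f K x) - f x := by
  refine csSup_le (Set.Nonempty.image _ ⟨x, hx⟩) ?_
  rintro _ ⟨z, hz, rfl⟩
  have h := hconv.add_inner_gradientWithin_le hf hx hz
  rw [inner_sub_right] at h
  change inner ℝ z _ - f z ≤ _
  rw [real_inner_comm _ z, real_inner_comm _ x]
  linarith

theorem gradientWithin_mem_gradientSpace (hconv : ConvexOn ℝ K f)
    (hf : DifferentiableOn ℝ f K) {x : Rd d} (hx : x ∈ K) :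
    gradientWithin f K x ∈ gradientSpace K f :=
  ⟨x, hx, fun _ hz => hconv.add_inner_gradientWithin_le hf hx hz⟩

end FenchelConj

/-- One round of accelerated Frank-Wolfe, for weights with `A β` the weight of the round. -/
theorem IsSmoothOn.accelerated_step {d : ℕ} {K : Set (Rd d)} {f : Rd d → ℝ} {lam L : ℝ}
    (hK : IsGaugeSet lam K) (hconv : ConvexOn ℝ K f) (hsm : IsSmoothOn (gauge K) L f K)
    {A β : ℝ} (hA : 0 ≤ A) (hβ0 : 0 ≤ β) (hβ1 : β ≤ 1) {w v v' x : Rd d} (hw : w ∈ K)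
    (hv : v ∈ K) (hv' : v' ∈ K) (hx : x ∈ K) :
    A * (f ((1 - β) • w + β • v') - f x) ≤ (A - A * β) * (f w - f x) +
      A * β * inner ℝ (gradientWithin f K ((1 - β) • w + β • v)) (v' - x) +
      L / 2 * (A * β ^ 2) * min (gauge K (v' - v)) (gauge K (v - v')) ^ 2 := by
  have hz : (1 - β) • w + β • v ∈ K := hK.convex hw hv (by linarith) hβ0 (by ring)
  have hw' : (1 - β) • w + β • v' ∈ K := hK.convex hw hv' (by linarith) hβ0 (by ring)
  have h1 := hsm.descent hK hz hw'
  have h2 := hconv.add_inner_gradientWithin_le hsm.1 hz hw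
  have h3 := hconv.add_inner_gradientWithin_le hsm.1 hz hx
  set z := (1 - β) • w + β • v with hzdef
  set G := gradientWithin f K z with hG
  have e1 : (1 - β) • w + β • v' - z = β • (v' - v) := by rw [hzdef]; module
  have e2 : z - ((1 - β) • w + β • v') = β • (v - v') := by rw [hzdef]; module
  rw [e1, e2, IsGaugeSet.gauge_smul hβ0, IsGaugeSet.gauge_smul hβ0,
    ← mul_min_of_nonneg _ _ hβ0] at h1
  set N := min (gauge K (v' - v)) (gauge K (v - v'))
  have ez : inner ℝ G z = (1 - β) * inner ℝ G w + β * inner ℝ G v := by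
    rw [hzdef, inner_add_right, inner_smul_right, inner_smul_right]
  rw [inner_smul_right, inner_sub_right] at h1
  rw [inner_sub_right, ez] at h2 h3
  rw [inner_sub_right]
  -- Descent is weighted by `A`, the gradient inequality by `A(1-β)` at `w` and `Aβ` at `x`; the
  -- terms `f z` and `⟨G, v⟩` cancel.
  have h1' := mul_le_mul_of_nonneg_left h1 hA
  have h2' := mul_le_mul_of_nonneg_left h2 (mul_nonneg hA (sub_nonneg.2 hβ1))
  have h3' := mul_le_mul_of_nonneg_left h3 (mul_nonneg hA hβ0)
  linarith

theorem isMinOn_clip_neg_half (c : ℝ) :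
    IsMinOn (fun r : ℝ => c * r + r ^ 2) (Set.Icc (0 : ℝ) 1) (max 0 (min 1 (-(c / 2)))) := by
  intro r hr
  obtain ⟨h0, h1⟩ := hr
  rw [Set.mem_ofPred_eq]
  rcases le_total (-(c / 2)) 0 with h | h
  · rw [max_eq_left ((min_le_right _ _).trans h)]
    nlinarith
  · rw [max_eq_right (le_min zero_le_one h)]
    rcases le_total 1 (-(c / 2)) with h' | h'
    · rw [min_eq_left h']
      nlinarith
    · rw [min_eq_right h']
      nlinarith [sq_nonneg (r + c / 2)]

theorem sum_Icc_one_natCast (n : ℕ) :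
    ∑ s ∈ Finset.Icc 1 n, (s : ℝ) = (n : ℝ) * ((n : ℝ) + 1) / 2 := by
  induction n with
  | zero => simp
  | succ n ih =>
    rw [Finset.sum_Icc_succ_top (by omega), ih]
    push_cast
    ring

/-! ### The iterates as weighted averages. -/

namespace gaugeFW

variable {d : ℕ} {lmo grad : Rd d → Rd d} {η : ℝ} {v₀ : Rd d}

theorem ζ_succ (n : ℕ) : (gaugeFW lmo grad η v₀ (n + 1)).ζ = (gaugeFW lmo grad η v₀ n).ζ +
    (η * ((n : ℝ) + 1)) • grad (gaugeFW lmo grad η v₀ (n + 1)).z := by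
  simp only [gaugeFW, gaugeFWStep, Nat.cast_add, Nat.cast_one]

theorem z_succ (n : ℕ) : (gaugeFW lmo grad η v₀ (n + 1)).z =
    (1 - 2 / ((n : ℝ) + 2)) • (gaugeFW lmo grad η v₀ n).w +
      (2 / ((n : ℝ) + 2)) • (gaugeFW lmo grad η v₀ n).v := by
  have h : ((n + 1 : ℕ) : ℝ) + 1 = (n : ℝ) + 2 := by push_cast; ring
  simp only [gaugeFW, gaugeFWStep, h]

theorem w_succ (n : ℕ) : (gaugeFW lmo grad η v₀ (n + 1)).w =
    (1 - 2 / ((n : ℝ) + 2)) • (gaugeFW lmo grad η v₀ n).w +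
      (2 / ((n : ℝ) + 2)) • (gaugeFW lmo grad η v₀ (n + 1)).v := by
  have h : ((n + 1 : ℕ) : ℝ) + 1 = (n : ℝ) + 2 := by push_cast; ring
  simp only [gaugeFW, gaugeFWStep, h]

theorem ρ_succ (n : ℕ) : (gaugeFW lmo grad η v₀ (n + 1)).ρ =
    max 0 (min 1 (-(inner ℝ (gaugeFW lmo grad η v₀ (n + 1)).ζ
      (gaugeFW lmo grad η v₀ (n + 1)).zstar / 2))) := rfl

theorem v_succ (n : ℕ) : (gaugeFW lmo grad η v₀ (n + 1)).v =
    (gaugeFW lmo grad η v₀ (n + 1)).ρ • (gaugeFW lmo grad η v₀ (n + 1)).zstar := rfl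

theorem ρ_mem_Icc (n : ℕ) : (gaugeFW lmo grad η v₀ n).ρ ∈ Set.Icc (0 : ℝ) 1 := by
  cases n with
  | zero => simp [gaugeFW]
  | succ n =>
    rw [ρ_succ]
    exact ⟨le_max_left _ _, max_le zero_le_one (min_le_left _ _)⟩

theorem two_div_mem_Icc (n : ℕ) : 2 / ((n : ℝ) + 2) ∈ Set.Icc (0 : ℝ) 1 := by
  refine ⟨by positivity, ?_⟩
  rw [div_le_one (by positivity)]
  linarith [n.cast_nonneg (α := ℝ)]

theorem ζ_eq_sum (n : ℕ) : (gaugeFW lmo grad η v₀ n).ζ =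
    ∑ s ∈ Finset.Icc 1 n, (η * (s : ℝ)) • grad (gaugeFW lmo grad η v₀ s).z := by
  induction n with
  | zero => simp [gaugeFW]
  | succ n ih =>
    rw [Finset.sum_Icc_succ_top (by omega), ζ_succ, ih]
    push_cast
    rfl

/-- The weight vanishes at `n = 0`, so `w₀` drops out. -/
theorem smul_w_eq_sum (n : ℕ) : ((n : ℝ) * ((n : ℝ) + 1) / 2) • (gaugeFW lmo grad η v₀ n).w =
    ∑ s ∈ Finset.Icc 1 n, (s : ℝ) • (gaugeFW lmo grad η v₀ s).v := by
  induction n with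
  | zero => simp
  | succ n ih =>
    rw [Finset.sum_Icc_succ_top (by omega), ← ih, w_succ, smul_add, smul_smul, smul_smul]
    have h : (n : ℝ) + 2 ≠ 0 := by positivity
    congr 2 <;> (push_cast; field_simp; ring)

/-- The query point is the next weighted average with `v_n` standing in for the unknown `v_{n+1}`:
the optimistic guess of the `y`-player. -/
theorem smul_z_succ (n : ℕ) : (((n : ℝ) + 1) * ((n : ℝ) + 2) / 2) •
      (gaugeFW lmo grad η v₀ (n + 1)).z =
    (∑ s ∈ Finset.Icc 1 n, (s : ℝ) • (gaugeFW lmo grad η v₀ s).v) +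
      ((n : ℝ) + 1) • (gaugeFW lmo grad η v₀ n).v := by
  rw [← smul_w_eq_sum, z_succ, smul_add, smul_smul, smul_smul]
  have h : (n : ℝ) + 2 ≠ 0 := by positivity
  congr 2
  · field_simp
    ring
  · field_simp

/-! ### Feasibility and the `x`-player. -/

section Oracle

variable {lam : ℝ} {K : Set (Rd d)}

theorem v_mem (hK : IsGaugeSet lam K) (hlmo : IsBoundaryLMO K lmo) (hv₀ : v₀ ∈ K) (n : ℕ) :
    (gaugeFW lmo grad η v₀ n).v ∈ K := by
  cases n with
  | zero => exact hv₀
  | succ n =>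
    rw [v_succ]
    have hρ := ρ_mem_Icc (lmo := lmo) (grad := grad) (η := η) (v₀ := v₀) (n + 1)
    exact hK.convex.smul_mem_of_zero_mem hK.zero_mem (hK.frontier_subset (hlmo _).1) hρ

theorem w_mem (hK : IsGaugeSet lam K) (hlmo : IsBoundaryLMO K lmo) (hv₀ : v₀ ∈ K) (n : ℕ) :
    (gaugeFW lmo grad η v₀ n).w ∈ K := by
  induction n with
  | zero => exact hv₀
  | succ n ih =>
    rw [w_succ]
    have h := two_div_mem_Icc n
    exact hK.convex ih (v_mem hK hlmo hv₀ _) (by linarith [h.2]) h.1 (by ring)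

theorem z_mem (hK : IsGaugeSet lam K) (hlmo : IsBoundaryLMO K lmo) (hv₀ : v₀ ∈ K) (n : ℕ) :
    (gaugeFW lmo grad η v₀ n).z ∈ K := by
  cases n with
  | zero => exact hv₀
  | succ n =>
    rw [z_succ]
    have h := two_div_mem_Icc n
    exact hK.convex (w_mem hK hlmo hv₀ _) (v_mem hK hlmo hv₀ _) (by linarith [h.2]) h.1 (by ring)

theorem growth (hK : IsGaugeSet lam K) (hd : 0 < d) (hlmo : IsBoundaryLMO K lmo) (n : ℕ)
    {x : Rd d} (hx : x ∈ K) :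
    inner ℝ (gaugeFW lmo grad η v₀ (n + 1)).ζ (gaugeFW lmo grad η v₀ (n + 1)).v +
        gauge K (gaugeFW lmo grad η v₀ (n + 1)).v ^ 2 +
        lam / 4 * min (gauge K (x - (gaugeFW lmo grad η v₀ (n + 1)).v))
          (gauge K ((gaugeFW lmo grad η v₀ (n + 1)).v - x)) ^ 2 ≤
      inner ℝ (gaugeFW lmo grad η v₀ (n + 1)).ζ x + gauge K x ^ 2 :=
  hK.inner_add_sq_gauge_growth hd (hlmo _).1 (hlmo _).2 (ρ_succ n) hx

theorem isBTRL (hK : IsGaugeSet lam K) (hd : 0 < d) (hlmo : IsBoundaryLMO K lmo)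
    (hv₀ : v₀ ∈ K) (hη : 0 < η) (f : Rd d → ℝ) (T : ℕ) :
    IsBTRL K (fun x => gauge K x ^ 2) η (fun t => (t : ℝ))
      (fun t u => fenchelPayoff K f u (grad (gaugeFW lmo grad η v₀ t).z)) T
      (fun t => (gaugeFW lmo grad η v₀ t).v) := by
  intro t ht _
  obtain ⟨n, rfl⟩ : ∃ n, t = n + 1 := ⟨t - 1, by omega⟩
  refine ⟨v_mem hK hlmo hv₀ _, fun u hu => ?_⟩
  -- Up to the factor `1/η` and a term independent of `x`, the objective is `⟨ζ, x⟩ + γ_K(x)²`.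
  have hsum : ∀ x : Rd d, (∑ s ∈ Finset.Icc 1 (n + 1), (s : ℝ) *
        fenchelPayoff K f x (grad (gaugeFW lmo grad η v₀ s).z)) + 1 / η * gauge K x ^ 2 =
      1 / η * (inner ℝ (gaugeFW lmo grad η v₀ (n + 1)).ζ x + gauge K x ^ 2) -
        ∑ s ∈ Finset.Icc 1 (n + 1), (s : ℝ) *
          fenchelConj K f (grad (gaugeFW lmo grad η v₀ s).z) := by
    intro x
    have h : 1 / η * inner ℝ (gaugeFW lmo grad η v₀ (n + 1)).ζ x =
        ∑ s ∈ Finset.Icc 1 (n + 1), (s : ℝ) *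
          inner ℝ x (grad (gaugeFW lmo grad η v₀ s).z) := by
      rw [ζ_eq_sum, sum_inner, Finset.mul_sum]
      refine Finset.sum_congr rfl fun s _ => ?_
      rw [real_inner_smul_left, real_inner_comm]
      field_simp
    rw [mul_add, h]
    simp only [fenchelPayoff, mul_sub, Finset.sum_sub_distrib]
    ring
  refine ((hsum _).trans_le ?_).trans_eq (hsum u).symm
  have hg := growth (grad := grad) (η := η) (v₀ := v₀) hK hd hlmo n hu
  have hlam := hK.lam_pos
  have h0 : 0 ≤ lam / 4 * min (gauge K (u - (gaugeFW lmo grad η v₀ (n + 1)).v))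
          (gauge K ((gaugeFW lmo grad η v₀ (n + 1)).v - u)) ^ 2 := by positivity
  exact sub_le_sub_right (mul_le_mul_of_nonneg_left (by linarith) (by positivity)) _

end Oracle

/-! ### The `y`-player and the convergence rate. -/

section Rate

variable {lam L : ℝ} {K : Set (Rd d)} {f : Rd d → ℝ}

theorem isOFTL (hK : IsGaugeSet lam K) (hlmo : IsBoundaryLMO K lmo) (hv₀ : v₀ ∈ K)
    (hconv : ConvexOn ℝ K f) (hf : DifferentiableOn ℝ f K) (T : ℕ) :
    IsOFTL (gradientSpace K f) (fun t => (t : ℝ))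
      (fun t u => -fenchelPayoff K f (gaugeFW lmo (gradientWithin f K) η v₀ (t - 1)).v u)
      (fun t u => -fenchelPayoff K f (gaugeFW lmo (gradientWithin f K) η v₀ t).v u) T
      (fun t => gradientWithin f K (gaugeFW lmo (gradientWithin f K) η v₀ t).z) := by
  intro t ht _
  obtain ⟨n, rfl⟩ : ∃ n, t = n + 1 := ⟨t - 1, by omega⟩
  have hz := z_mem (grad := gradientWithin f K) (η := η) hK hlmo hv₀ (n + 1)
  refine ⟨gradientWithin_mem_gradientSpace hconv hf hz, fun u _ => ?_⟩
  set S := gaugeFW lmo (gradientWithin f K) η v₀ with hS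
  -- The objective is a positive multiple of `f*(y) - ⟨z, y⟩`, which the gradient at `z` minimizes
  -- over all `y` by Fenchel–Young.
  have hsum : ∀ y : Rd d, ((n + 1 : ℕ) : ℝ) * -fenchelPayoff K f (S (n + 1 - 1)).v y +
      ∑ s ∈ Finset.Ico 1 (n + 1), (s : ℝ) * -fenchelPayoff K f (S s).v y =
      ((n : ℝ) + 1) * ((n : ℝ) + 2) / 2 * (fenchelConj K f y - inner ℝ (S (n + 1)).z y) := by
    intro y
    have h := congrArg (fun x : Rd d => (inner ℝ x y : ℝ))
      (smul_z_succ (lmo := lmo) (grad := gradientWithin f K) (η := η) (v₀ := v₀) n)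
    simp only [inner_add_left, sum_inner, real_inner_smul_left, ← hS] at h
    rw [mul_sub, h]
    have hIco : Finset.Ico 1 (n + 1) = Finset.Icc 1 n := by
      ext s
      simp only [Finset.mem_Ico, Finset.mem_Icc]
      omega
    simp only [fenchelPayoff, neg_sub, mul_sub, Finset.sum_sub_distrib, ← Finset.sum_mul, hIco,
      sum_Icc_one_natCast, Nat.add_sub_cancel, Nat.cast_add, Nat.cast_one]
    ring
  refine ((hsum _).trans_le ?_).trans_eq (hsum u).symm
  have h1 := fenchelConj_gradientWithin_le hconv hf hz
  have h2 := inner_sub_le_fenchelConj hK.isCompact hf.continuousOn hz u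
  exact mul_le_mul_of_nonneg_left (by linarith) (by positivity)

theorem potential_le (hK : IsGaugeSet lam K) (hd : 0 < d) (hlmo : IsBoundaryLMO K lmo)
    (hv₀ : v₀ ∈ K) (hconv : ConvexOn ℝ K f) (hsm : IsSmoothOn (gauge K) L f K) (hL : 0 < L)
    (hη : 0 < η) (hηL : η * L ≤ lam / 4) {x : Rd d} (hx : x ∈ K) (n : ℕ) :
    η * (((n : ℝ) + 1) * ((n : ℝ) + 2) / 2 *
          (f (gaugeFW lmo (gradientWithin f K) η v₀ (n + 1)).w - f x)) +
        inner ℝ (gaugeFW lmo (gradientWithin f K) η v₀ (n + 1)).ζ x ≤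
      inner ℝ (gaugeFW lmo (gradientWithin f K) η v₀ (n + 1)).ζ
          (gaugeFW lmo (gradientWithin f K) η v₀ (n + 1)).v +
        gauge K (gaugeFW lmo (gradientWithin f K) η v₀ (n + 1)).v ^ 2 +
        η * L * gauge K v₀ ^ 2 := by
  -- For `t = n + 1`, `A = t(t+1)/2` and `β = 2/(t+1)`, one has `Aβ = t` and `Aβ² = 2t/(t+1)`; `η t`
  -- times the gradient is the increment of `ζ`.
  have step : ∀ n : ℕ, η * (((n : ℝ) + 1) * ((n : ℝ) + 2) / 2 *
          (f (gaugeFW lmo (gradientWithin f K) η v₀ (n + 1)).w - f x)) ≤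
      η * ((n : ℝ) * ((n : ℝ) + 1) / 2 *
          (f (gaugeFW lmo (gradientWithin f K) η v₀ n).w - f x)) +
        (inner ℝ (gaugeFW lmo (gradientWithin f K) η v₀ (n + 1)).ζ
            (gaugeFW lmo (gradientWithin f K) η v₀ (n + 1)).v -
          inner ℝ (gaugeFW lmo (gradientWithin f K) η v₀ (n + 1)).ζ x) -
        (inner ℝ (gaugeFW lmo (gradientWithin f K) η v₀ n).ζ
            (gaugeFW lmo (gradientWithin f K) η v₀ (n + 1)).v -
          inner ℝ (gaugeFW lmo (gradientWithin f K) η v₀ n).ζ x) +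
        η * L * (((n : ℝ) + 1) / ((n : ℝ) + 2)) *
          min (gauge K ((gaugeFW lmo (gradientWithin f K) η v₀ (n + 1)).v -
              (gaugeFW lmo (gradientWithin f K) η v₀ n).v))
            (gauge K ((gaugeFW lmo (gradientWithin f K) η v₀ n).v -
              (gaugeFW lmo (gradientWithin f K) η v₀ (n + 1)).v)) ^ 2 := by
    intro n
    have hβ := two_div_mem_Icc n
    have hn : (n : ℝ) + 2 ≠ 0 := by positivity
    have h := hsm.accelerated_step hK hconv (A := ((n : ℝ) + 1) * ((n : ℝ) + 2) / 2)
      (by positivity) hβ.1 hβ.2 (w_mem (grad := gradientWithin f K) (η := η) hK hlmo hv₀ n)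
      (v_mem (grad := gradientWithin f K) (η := η) hK hlmo hv₀ n)
      (v_mem (grad := gradientWithin f K) (η := η) hK hlmo hv₀ (n + 1)) hx
    have e1 : ((n : ℝ) + 1) * ((n : ℝ) + 2) / 2 * (2 / ((n : ℝ) + 2)) = (n : ℝ) + 1 := by
      field_simp
    have e2 : ((n : ℝ) + 1) * ((n : ℝ) + 2) / 2 * (2 / ((n : ℝ) + 2)) ^ 2 =
        2 * (((n : ℝ) + 1) / ((n : ℝ) + 2)) := by
      field_simp
    rw [← w_succ, ← z_succ, e2, e1, inner_sub_right] at h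
    have h' := mul_le_mul_of_nonneg_left h hη.le
    rw [ζ_succ n]
    simp only [inner_add_left, real_inner_smul_left]
    linarith
  have hlam := hK.lam_pos
  induction n with
  | zero =>
    have h := step 0
    set S := gaugeFW lmo (gradientWithin f K) η v₀ with hS
    have hζ : (S 0).ζ = 0 := rfl
    have hv : (S 0).v = v₀ := rfl
    rw [hζ, hv] at h
    simp only [inner_zero_left, Nat.cast_zero, zero_add, zero_mul, zero_div, mul_zero] at h ⊢
    set v := (S 1).v
    -- The first round carries the factor `1/2`, so its cost is at most `ηL γ_K(v₀)² + ηL γ_K(-v)²`,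
    -- and the second term is at most `γ_K(v)²`.
    have hN : min (gauge K (v - v₀)) (gauge K (v₀ - v)) ^ 2 ≤
        2 * gauge K v₀ ^ 2 + 2 * gauge K (-v) ^ 2 := by
      have h1 : min (gauge K (v - v₀)) (gauge K (v₀ - v)) ≤ gauge K v₀ + gauge K (-v) := by
        refine (min_le_right _ _).trans ?_
        rw [sub_eq_add_neg]
        exact hK.gauge_add_le _ _
      have h0 : 0 ≤ min (gauge K (v - v₀)) (gauge K (v₀ - v)) :=
        le_min (gauge_nonneg _) (gauge_nonneg _)
      nlinarith [pow_le_pow_left₀ h0 h1 2, sq_nonneg (gauge K v₀ - gauge K (-v))]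
    have h2 := hK.mul_sq_gauge_neg_le v
    have h3 : η * L * gauge K (-v) ^ 2 ≤ lam / 4 * gauge K (-v) ^ 2 :=
      mul_le_mul_of_nonneg_right hηL (sq_nonneg _)
    have h4 := mul_le_mul_of_nonneg_left hN (mul_pos hη hL).le
    linarith
  | succ n ih =>
    have h := step (n + 1)
    -- The old objective at the new point `v_{n+2}` exceeds its minimum by `(lam/4) N²`, which pays
    -- for the smoothness error.
    have hg := growth (grad := gradientWithin f K) (η := η) (v₀ := v₀) hK hd hlmo n
      (v_mem (grad := gradientWithin f K) (η := η) hK hlmo hv₀ (n + 2))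
    set S := gaugeFW lmo (gradientWithin f K) η v₀ with hS
    change _ ≤ _ + (inner ℝ (S (n + 2)).ζ (S (n + 2)).v - _) - _ + _ at h
    change η * (_ * (f (S (n + 2)).w - f x)) + inner ℝ (S (n + 2)).ζ x ≤
      inner ℝ (S (n + 2)).ζ (S (n + 2)).v + gauge K (S (n + 2)).v ^ 2 + _
    push_cast at h ⊢
    set N := min (gauge K ((S (n + 2)).v - (S (n + 1)).v))
      (gauge K ((S (n + 1)).v - (S (n + 2)).v))
    have h1 : η * L * (((n : ℝ) + 1 + 1) / ((n : ℝ) + 1 + 2)) * N ^ 2 ≤ lam / 4 * N ^ 2 := by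
      refine mul_le_mul_of_nonneg_right ?_ (sq_nonneg N)
      have : ((n : ℝ) + 1 + 1) / ((n : ℝ) + 1 + 2) ≤ 1 := by
        rw [div_le_one (by positivity)]
        linarith
      calc _ ≤ η * L * 1 := mul_le_mul_of_nonneg_left this (mul_pos hη hL).le
        _ ≤ _ := by linarith
    have e : ((n : ℝ) + 1) * ((n : ℝ) + 1 + 1) / 2 = ((n : ℝ) + 1) * ((n : ℝ) + 2) / 2 := by ring
    rw [e] at h
    linarith

theorem rate (hK : IsGaugeSet lam K) (hd : 0 < d) (hlmo : IsBoundaryLMO K lmo)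
    (hv₀ : v₀ ∈ K) (hconv : ConvexOn ℝ K f) (hsm : IsSmoothOn (gauge K) L f K) (hL : 0 < L)
    (hη : 0 < η) (hηL : η * L ≤ lam / 4) {x : Rd d} (hx : x ∈ K) {T : ℕ} (hT : 1 ≤ T) :
    (T : ℝ) ^ 2 / 2 * (f (gaugeFW lmo (gradientWithin f K) η v₀ T).w - f x) ≤
      1 / η + L * gauge K v₀ ^ 2 := by
  obtain ⟨n, rfl⟩ : ∃ n, T = n + 1 := ⟨T - 1, by omega⟩
  have h := potential_le hK hd hlmo hv₀ hconv hsm hL hη hηL hx n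
  have hg := growth (grad := gradientWithin f K) (η := η) (v₀ := v₀) hK hd hlmo n hx
  have hlam := hK.lam_pos
  have h0 : 0 ≤ lam / 4 *
      min (gauge K (x - (gaugeFW lmo (gradientWithin f K) η v₀ (n + 1)).v))
        (gauge K ((gaugeFW lmo (gradientWithin f K) η v₀ (n + 1)).v - x)) ^ 2 := by positivity
  have hx1 : gauge K x ^ 2 ≤ 1 := by
    have := pow_le_pow_left₀ (gauge_nonneg x) (hK.gauge_le_one_iff.2 hx) 2
    rwa [one_pow] at this
  set D := f (gaugeFW lmo (gradientWithin f K) η v₀ (n + 1)).w - f x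
  -- Replacing `(n+1)(n+2)` by `(n+1)²` requires `D ≥ 0`; otherwise the claim is trivial.
  rcases le_total D 0 with hD | hD
  · exact (mul_nonpos_of_nonneg_of_nonpos (by positivity) hD).trans (by positivity)
  have h1 : η * (((n : ℝ) + 1) * ((n : ℝ) + 2) / 2 * D) ≤ η * (1 / η + L * gauge K v₀ ^ 2) := by
    rw [mul_add η, mul_one_div_cancel hη.ne']
    linarith
  refine le_trans ?_ (le_of_mul_le_mul_left h1 hη)
  refine mul_le_mul_of_nonneg_right ?_ hD
  push_cast
  nlinarith [n.cast_nonneg (α := ℝ)]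

end Rate

end gaugeFW

/-! ### Assembly of the theorem. -/

theorem mainTheorem5 (d : ℕ) (hd : 0 < d) (lam L C η : ℝ) (K : Set (Rd d)) (f : Rd d → ℝ)
    (hK : IsGaugeSet lam K)
    (hL : 0 < L)
    (hconv : ConvexOn ℝ K f)
    (hsmooth : IsSmoothOn (gauge K) L f K)
    (hC : 4 ≤ C)
    (hη_lower : 1 / (C * L) ≤ η / lam)
    (hη_upper : η / lam ≤ 1 / (4 * L)) :
    -- the linear minimization problems over the boundary are solvable
    (∃ lmo : Rd d → Rd d, IsBoundaryLMO K lmo) ∧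
    -- the minimum of `f` over `K` is attained
    ∃ fmin : ℝ, IsLeast (f '' K) fmin ∧
    ∀ lmo : Rd d → Rd d, IsBoundaryLMO K lmo →
    ∀ v₀ ∈ K, ∀ T : ℕ, 1 ≤ T →
    ∀ S : ℕ → GaugeFWState d, S = gaugeFW lmo (gradientWithin f K) η v₀ →
      -- `ρ_t` solves the one-dimensional quadratic problem
      (∀ t : ℕ, 1 ≤ t → t ≤ T → (S t).ρ ∈ Set.Icc (0 : ℝ) 1 ∧
        IsMinOn (fun r : ℝ => inner ℝ (S t).ζ (S t).zstar * r + r ^ 2) (Set.Icc (0 : ℝ) 1)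
          (S t).ρ) ∧
      -- the iterates are the play of OFTL against BTRL with the squared gauge and `α_t = t`
      IsFenchelGamePlay K f (fun x => gauge K x ^ 2) η (fun t => (t : ℝ)) T
        (fun t => (S t).v) (fun t => gradientWithin f K (S t).z) ∧
      -- and the output is the weighted average of the `x`-player's moves
      (S T).w = (∑ t ∈ Finset.Icc 1 T, (t : ℝ))⁻¹ • ∑ t ∈ Finset.Icc 1 T, (t : ℝ) • (S t).v ∧
      (S T).w ∈ K ∧
      -- the rate, from the minimizer of the regularizer and from a general initial point
      (v₀ = 0 → f (S T).w - fmin ≤ 2 * C * L / (lam * (T : ℝ) ^ 2)) ∧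
      f (S T).w - fmin ≤
        2 * C * L / (lam * (T : ℝ) ^ 2) + 2 * L * gauge K v₀ ^ 2 / (T : ℝ) ^ 2 := by
  have hcont : ContinuousOn f K := hsmooth.1.continuousOn
  obtain ⟨x, hx, hmin⟩ := hK.isCompact.exists_isMinOn ⟨0, hK.zero_mem⟩ hcont
  have hlam := hK.lam_pos
  have hCL : 0 < C * L := mul_pos (by linarith) hL
  have hη : 0 < η := by
    have h := lt_of_lt_of_le (one_div_pos.2 hCL) hη_lower
    exact (div_pos_iff_of_pos_right hlam).1 h
  have hηL : η * L ≤ lam / 4 := by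
    rw [div_le_div_iff₀ hlam (by linarith)] at hη_upper
    linarith
  have hηinv : 1 / η ≤ C * L / lam := by
    rw [div_le_div_iff₀ hCL hlam] at hη_lower
    rw [div_le_div_iff₀ hη hlam]
    linarith
  refine ⟨hK.exists_boundaryLMO hd, f x, ⟨⟨x, hx, rfl⟩, ?_⟩, ?_⟩
  · rintro _ ⟨u, hu, rfl⟩
    exact hmin hu
  rintro lmo hlmo v₀ hv₀ T hT S rfl
  have hTpos : (0 : ℝ) < T := by exact_mod_cast hT
  have hrate : f (gaugeFW lmo (gradientWithin f K) η v₀ T).w - f x ≤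
      2 * C * L / (lam * (T : ℝ) ^ 2) + 2 * L * gauge K v₀ ^ 2 / (T : ℝ) ^ 2 := by
    have h := gaugeFW.rate hK hd hlmo hv₀ hconv hsmooth hL hη hηL hx hT
    have h2 : (T : ℝ) ^ 2 / 2 * (f (gaugeFW lmo (gradientWithin f K) η v₀ T).w - f x) ≤
        (T : ℝ) ^ 2 / 2 *
          (2 * C * L / (lam * (T : ℝ) ^ 2) + 2 * L * gauge K v₀ ^ 2 / (T : ℝ) ^ 2) := by
      calc _ ≤ C * L / lam + L * gauge K v₀ ^ 2 := by linarith
        _ = _ := by field_simp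
    exact le_of_mul_le_mul_left h2 (by positivity)
  refine ⟨?_, ⟨?_, ?_⟩, ?_, gaugeFW.w_mem hK hlmo hv₀ T, ?_, hrate⟩
  · intro t ht _
    obtain ⟨n, rfl⟩ : ∃ n, t = n + 1 := ⟨t - 1, by omega⟩
    refine ⟨gaugeFW.ρ_mem_Icc _, ?_⟩
    rw [gaugeFW.ρ_succ]
    exact isMinOn_clip_neg_half _
  · exact gaugeFW.isOFTL hK hlmo hv₀ hconv hsmooth.1 T
  · exact gaugeFW.isBTRL hK hd hlmo hv₀ hη f T
  · rw [← gaugeFW.smul_w_eq_sum, sum_Icc_one_natCast, smul_smul, inv_mul_cancel₀ (by positivity),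
      one_smul]
  · rintro rfl
    simpa using hrate
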